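/- For a finite set $B\subset\mathbb{R}$ let $\mathbf{E}^+(B)$ be the number of quadruples $(a_1,a_2,b_1,b_2)\in B^4$ with $a_1+b_1=a_2+b_2$, and let $\mathbf{E}^\times(B)$ be the number of quadruples $(a_1,a_2,b_1,b_2)\in B^4$ with $a_1b_1=a_2b_2$. There are absolute constants $\kappa, C, c>0$ such that the following holds for every finite set $A\subset\mathbb{R}$ with $|A|\ge 2$. There is a set $A_1\subseteq A$ with $$|A_1|\ge \kappa\,\mathbf{E}^\times(A)^{1/3}\quad\text{and}\quad \mathbf{E}^+(A_1)\,\mathbf{E}^\times(A)\le C\,|A|^{11/2}(\log|A|)^c,$$ and there is a set $A_2\subseteq A$ with $$|A_2|\ge \kappa\,\mathbf{E}^+(A)^{1/3}\quad\text{and}\quad \mathbf{E}^\times(A_2)\,\mathbf{E}^+(A)\le C\,|A|^{11/2}(\log|A|)^c.$$ -/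

import Mathlib

/-! Both halves are one argument about two operations `f`, `h` (product and sum, in either order).
Let N = |A|, let M be the `f`-energy of A, and ignore constants and logarithms. The elements whose
share of M is at least half the average carry half of M, and Cauchy–Schwarz forces at least M^(1/3)
of them. Sort the values of `f` dyadically by multiplicity: each such a has, for some j, at least θ
≈ M/(N 2^j) partners c with `f a c` in the set P of values of multiplicity about 2^j, and |P| 4^j ≤
M (`exists_popular_decomposition`).

For `h a b` = x, the identity ac = cx - cb, or a + c = c + x b⁻¹, puts a point of a grid P × S on a
line indexed by (c, x). If X is the set of x with at least τ representations, this gives θτ|X|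
incidences with at most N|X| lines. An elementary Szemerédi–Trotter bound for grids
(`card_incidences_le`) yields (θτ)³|X| ≲ N²|P|²|S|², and with τ|X| ≤ N² also (τ²|X|)²θ³ ≲ N⁶|P|²
(`rich_bound`). A dyadic choice of τ makes τ²|X| the `h`-energy of the class against S; inserting
|P| ≤ M/4^j, θ ≤ N and M ≲ N 2^j θ bounds the square of energy times M by N¹¹ (`class_bound`). The
classes are then glued at a logarithmic cost. -/

/-! ### Coincidence counts, Cauchy–Schwarz and dyadic pigeonholing. -/

/-- The number of ordered pairs of elements of `X` on which `φ` agrees. -/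
def collisions {ι γ : Type*} [DecidableEq γ] (φ : ι → γ) (X : Finset ι) : ℕ :=
  ((X ×ˢ X).filter fun q => φ q.1 = φ q.2).card

/-- The number of elements of `X` that `φ` sends to `y`. -/
def fiberCard {ι γ : Type*} [DecidableEq γ] (φ : ι → γ) (X : Finset ι) (y : γ) : ℕ :=
  (X.filter fun i => φ i = y).card

theorem card_agree_eq_sum {ι κ γ : Type*} [DecidableEq γ] (φ : ι → γ) (ψ : κ → γ)
    (X : Finset ι) (Y : Finset κ) :
    ((X ×ˢ Y).filter fun q => φ q.1 = ψ q.2).card = ∑ i ∈ X, fiberCard ψ Y (φ i) := by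
  rw [Finset.card_filter, Finset.sum_product]
  refine Finset.sum_congr rfl fun i _ => ?_
  rw [fiberCard, Finset.card_filter]
  exact Finset.sum_congr rfl fun j _ => by simp only [eq_comm]

theorem sum_comp_eq_sum_fiberCard {ι γ : Type*} [DecidableEq γ] (φ : ι → γ) (X : Finset ι)
    (Z : Finset γ) (h : ∀ i ∈ X, φ i ∈ Z) (u : γ → ℕ) :
    ∑ i ∈ X, u (φ i) = ∑ y ∈ Z, fiberCard φ X y * u y := by
  rw [← Finset.sum_fiberwise_of_maps_to h]
  refine Finset.sum_congr rfl fun y _ => ?_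
  rw [Finset.sum_congr rfl (g := fun _ => u y)]
  · simp [fiberCard]
  · intro i hi
    rw [(Finset.mem_filter.1 hi).2]

theorem collisions_eq_sum {ι γ : Type*} [DecidableEq γ] (φ : ι → γ) (X : Finset ι) :
    collisions φ X = ∑ i ∈ X, fiberCard φ X (φ i) :=
  card_agree_eq_sum φ φ X X

theorem collisions_eq_sum_sq {ι γ : Type*} [DecidableEq γ] (φ : ι → γ) (X : Finset ι)
    (Z : Finset γ) (h : ∀ i ∈ X, φ i ∈ Z) :
    collisions φ X = ∑ y ∈ Z, fiberCard φ X y ^ 2 := by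
  rw [collisions_eq_sum, sum_comp_eq_sum_fiberCard φ X Z h]
  simp only [sq]

theorem card_eq_sum_fiberCard {ι γ : Type*} [DecidableEq γ] (φ : ι → γ) (X : Finset ι)
    (Z : Finset γ) (h : ∀ i ∈ X, φ i ∈ Z) : X.card = ∑ y ∈ Z, fiberCard φ X y := by
  simpa using sum_comp_eq_sum_fiberCard φ X Z h fun _ => 1

theorem card_agree_sq_le {ι κ γ : Type*} [DecidableEq γ] (φ : ι → γ) (ψ : κ → γ)
    (X : Finset ι) (Y : Finset κ) :
    ((X ×ˢ Y).filter fun q => φ q.1 = ψ q.2).card ^ 2 ≤ collisions φ X * collisions ψ Y := by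
  have hX : ∀ i ∈ X, φ i ∈ X.image φ ∪ Y.image ψ := fun i hi =>
    Finset.mem_union_left _ (Finset.mem_image_of_mem _ hi)
  have hY : ∀ i ∈ Y, ψ i ∈ X.image φ ∪ Y.image ψ := fun i hi =>
    Finset.mem_union_right _ (Finset.mem_image_of_mem _ hi)
  rw [card_agree_eq_sum, sum_comp_eq_sum_fiberCard φ X _ hX, collisions_eq_sum_sq φ X _ hX,
    collisions_eq_sum_sq ψ Y _ hY]
  exact Finset.sum_mul_sq_le_sq_mul_sq _ _ _

theorem sum_fiberCard_sq_le {ι γ : Type*} [DecidableEq γ] (φ : ι → γ) (X Y : Finset ι) :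
    (∑ i ∈ X, fiberCard φ Y (φ i)) ^ 2 ≤ collisions φ X * collisions φ Y := by
  rw [← card_agree_eq_sum]
  exact card_agree_sq_le φ φ X Y

theorem exists_le_card_mul_of_le_sum (J m : ℕ) (hm : 0 < m) (u : ℕ → ℕ)
    (h : m ≤ ∑ i ∈ Finset.range J, u i) : ∃ i ∈ Finset.range J, m ≤ J * u i := by
  have hne : (Finset.range J).Nonempty := by
    rw [Finset.nonempty_iff_ne_empty]
    intro h0
    rw [h0, Finset.sum_empty] at h
    omega
  obtain ⟨i, hi, hmax⟩ := Finset.exists_max_image (Finset.range J) u hne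
  refine ⟨i, hi, h.trans ?_⟩
  simpa using Finset.sum_le_card_nsmul (Finset.range J) u (u i) hmax

/-- Fibres of size in [2^i, 2^(i+1)) contribute at most 4·4^i each; one of the J scales carries a
1/J share. -/
theorem collisions_le_dyadic {ι γ : Type*} [DecidableEq γ] (φ : ι → γ) (X : Finset ι) (J : ℕ)
    (hJ : ∀ y, fiberCard φ X y < 2 ^ J) (hpos : 0 < collisions φ X) :
    ∃ i, collisions φ X ≤
      4 * J * ((2 ^ i) ^ 2 * ((X.image φ).filter fun y => 2 ^ i ≤ fiberCard φ X y).card) := by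
  have hX : ∀ i ∈ X, φ i ∈ X.image φ := fun i hi => Finset.mem_image_of_mem _ hi
  have hfp : ∀ y ∈ X.image φ, fiberCard φ X y ≠ 0 := by
    intro y hy
    obtain ⟨i, hi, rfl⟩ := Finset.mem_image.1 hy
    exact Finset.card_ne_zero_of_mem (Finset.mem_filter.2 ⟨hi, rfl⟩)
  have key : collisions φ X ≤ ∑ i ∈ Finset.range J,
      4 * ((2 ^ i) ^ 2 * ((X.image φ).filter fun y => 2 ^ i ≤ fiberCard φ X y).card) := by
    rw [collisions_eq_sum_sq φ X _ hX, ← Finset.sum_fiberwise_of_maps_to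
      (t := Finset.range J) (g := fun y => Nat.log 2 (fiberCard φ X y))]
    · refine Finset.sum_le_sum fun i _ => ?_
      calc _ ≤ ((X.image φ).filter fun y => Nat.log 2 (fiberCard φ X y) = i).card •
              (4 * (2 ^ i) ^ 2) := by
            refine Finset.sum_le_card_nsmul _ _ _ fun y hy => ?_
            have hlog := (Finset.mem_filter.1 hy).2
            have := Nat.lt_pow_succ_log_self (b := 2) (by norm_num) (fiberCard φ X y)
            rw [hlog, pow_succ] at this
            nlinarith
        _ ≤ ((X.image φ).filter fun y => 2 ^ i ≤ fiberCard φ X y).card • (4 * (2 ^ i) ^ 2) := by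
            gcongr with y hy
            intro hlog
            rw [← hlog]
            exact Nat.pow_log_le_self 2 (hfp y hy)
        _ = _ := by rw [smul_eq_mul]; ring
    · intro y hy
      exact Finset.mem_range.2 (Nat.log_lt_of_lt_pow (hfp y hy) (hJ y))
  obtain ⟨i, _, hi⟩ := exists_le_card_mul_of_le_sum J _ hpos _ key
  exact ⟨i, hi.trans_eq (by ring)⟩

/-- This is 2k ≤ 1 + k² for integers k, summed over the K possible keys. -/
theorem two_mul_card_le_add_collisions {ι : Type*} (key : ι → ℕ) (X : Finset ι) (K : ℕ)
    (h : ∀ i ∈ X, key i < K) : 2 * X.card ≤ K + collisions key X := by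
  have h' : ∀ i ∈ X, key i ∈ Finset.range K := fun i hi => Finset.mem_range.2 (h i hi)
  rw [collisions_eq_sum_sq key X _ h', card_eq_sum_fiberCard key X _ h', Finset.mul_sum]
  calc _ ≤ ∑ y ∈ Finset.range K, (1 + fiberCard key X y ^ 2) := by
        refine Finset.sum_le_sum fun y _ => ?_
        rcases Nat.lt_or_ge (fiberCard key X y) 2 with h2 | h2
        · interval_cases fiberCard key X y <;> norm_num
        · nlinarith
    _ = _ := by simp [Finset.sum_add_distrib]

/-! ### Incidences between lines and a grid. -/

/-- The index of the block of `d` consecutive elements of `S` in which `x` lies. -/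
noncomputable def blockIndex (S : Finset ℝ) (d : ℕ) (x : ℝ) : ℕ := (S.filter (· < x)).card / d

theorem blockIndex_mono (S : Finset ℝ) (d : ℕ) : Monotone (blockIndex S d) := by
  intro x y hxy
  refine Nat.div_le_div_right (Finset.card_le_card fun z hz => ?_)
  rw [Finset.mem_filter] at hz ⊢
  exact ⟨hz.1, hz.2.trans_le hxy⟩

theorem blockIndex_le (S : Finset ℝ) (d : ℕ) (x : ℝ) : blockIndex S d x ≤ S.card / d :=
  Nat.div_le_div_right (Finset.card_filter_le _ _)

/-- The rank of x in S is injective on S, and a block confines it to an interval of d integers. -/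
theorem fiberCard_blockIndex_le (S : Finset ℝ) (d : ℕ) (hd : 0 < d) (k : ℕ) :
    fiberCard (blockIndex S d) S k ≤ d := by
  have : (Finset.Ico (k * d) (k * d + d)).card = d := by simp
  rw [fiberCard]
  refine le_trans (Finset.card_le_card_of_injOn (fun x => (S.filter (· < x)).card) ?_ ?_) this.le
  · intro x hx
    have hx := (Finset.mem_filter.1 hx).2
    rw [blockIndex, Nat.div_eq_iff hd] at hx
    simp only [Finset.coe_Ico, Set.mem_Ico]
    omega
  · have hlt : ∀ x ∈ S, ∀ y, x < y → (S.filter (· < x)).card < (S.filter (· < y)).card := by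
      intro x hx y hxy
      refine Finset.card_lt_card (Finset.ssubset_iff_of_subset ?_ |>.2 ⟨x, ?_, ?_⟩)
      · intro z hz
        rw [Finset.mem_filter] at hz ⊢
        exact ⟨hz.1, hz.2.trans hxy⟩
      · exact Finset.mem_filter.2 ⟨hx, hxy⟩
      · simp
    intro x hx y hy hxy
    have hx := (Finset.mem_filter.1 hx).1
    have hy := (Finset.mem_filter.1 hy).1
    rcases lt_trichotomy x y with h | h | h
    · exact absurd hxy (hlt x hx y h).ne
    · exact h
    · exact absurd hxy (hlt y hy x h).ne'

theorem collisions_blockIndex_le (S : Finset ℝ) (d : ℕ) (hd : 0 < d) :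
    collisions (blockIndex S d) S ≤ S.card * d := by
  rw [collisions_eq_sum]
  simpa using Finset.sum_le_card_nsmul S _ d fun x _ => fiberCard_blockIndex_le S d hd _

/-- Incidences between a grid `S × T` and the non-degenerate lines `x = l.1 + l.2 * y`. -/
theorem card_incidences_le (S T : Finset ℝ) (L : Finset (ℝ × ℝ)) (hL : ∀ l ∈ L, l.2 ≠ 0)
    (d e : ℕ) (hd : 0 < d) (he : 0 < e) :
    ((L ×ˢ T).filter fun q => q.1.1 + q.1.2 * q.2 ∈ S).card ≤
      (S.card / d + T.card / e + 1) * L.card + (S.card * d) * (T.card * e) := by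
  set K := S.card / d + T.card / e + 1 with hK
  let X : ℝ × ℝ → Finset ℝ := fun l => T.filter fun t => l.1 + l.2 * t ∈ S
  let sameCell : ℝ × ℝ → ℝ × ℝ → Prop := fun l q =>
    blockIndex S d (l.1 + l.2 * q.1) = blockIndex S d (l.1 + l.2 * q.2) ∧
      blockIndex T e q.1 = blockIndex T e q.2
  let Q : ℝ × ℝ → Finset (ℝ × ℝ) := fun l =>
    ((X l) ×ˢ (X l)).filter fun q => q.1 ≠ q.2 ∧ sameCell l q
  have hcard : ((L ×ˢ T).filter fun q => q.1.1 + q.1.2 * q.2 ∈ S).card = ∑ l ∈ L, (X l).card := by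
    rw [Finset.card_filter, Finset.sum_product]
    refine Finset.sum_congr rfl fun l _ => ?_
    rw [Finset.card_filter]
  have hline : ∀ l ∈ L, (X l).card ≤ K + (Q l).card := by
    intro l hl
    -- Along a line of nonzero slope both block indices are monotone, so their sum, with the first
    -- index reversed for negative slope, is constant only within a cell. Hence the line meets at
    -- most K cells.
    have hex : ∃ key : ℝ → ℕ, (∀ t, key t < K) ∧
        ∀ t t', key t = key t' → sameCell l (t, t') := by
      rcases lt_or_gt_of_ne (hL l hl) with hneg | hpos
      · have mono : ∀ t t', t ≤ t' → S.card / d - blockIndex S d (l.1 + l.2 * t) + blockIndex T e t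
            = S.card / d - blockIndex S d (l.1 + l.2 * t') + blockIndex T e t' →
            sameCell l (t, t') := by
          intro t t' htt h
          have h1 := blockIndex_mono T e htt
          have h2 : blockIndex S d (l.1 + l.2 * t') ≤ blockIndex S d (l.1 + l.2 * t) :=
            blockIndex_mono S d (by nlinarith)
          have h3 := blockIndex_le S d (l.1 + l.2 * t)
          constructor <;> dsimp only <;> omega
        refine ⟨fun t => S.card / d - blockIndex S d (l.1 + l.2 * t) + blockIndex T e t,
          fun t => ?_, fun t t' h => ?_⟩
        · have := blockIndex_le T e t
          have := blockIndex_le S d (l.1 + l.2 * t)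
          dsimp only
          omega
        · rcases le_total t t' with htt | htt
          · exact mono t t' htt h
          · have := mono t' t htt h.symm
            exact ⟨this.1.symm, this.2.symm⟩
      · have mono : ∀ t t', t ≤ t' → blockIndex S d (l.1 + l.2 * t) + blockIndex T e t
            = blockIndex S d (l.1 + l.2 * t') + blockIndex T e t' → sameCell l (t, t') := by
          intro t t' htt h
          have h1 := blockIndex_mono T e htt
          have h2 : blockIndex S d (l.1 + l.2 * t) ≤ blockIndex S d (l.1 + l.2 * t') :=
            blockIndex_mono S d (by nlinarith)
          constructor <;> dsimp only <;> omega
        refine ⟨fun t => blockIndex S d (l.1 + l.2 * t) + blockIndex T e t,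
          fun t => ?_, fun t t' h => ?_⟩
        · have := blockIndex_le T e t
          have := blockIndex_le S d (l.1 + l.2 * t)
          dsimp only
          omega
        · rcases le_total t t' with htt | htt
          · exact mono t t' htt h
          · have := mono t' t htt h.symm
            exact ⟨this.1.symm, this.2.symm⟩
    obtain ⟨key, hkey, hcell⟩ := hex
    have h2 := two_mul_card_le_add_collisions key (X l) K fun t _ => hkey t
    have h3 : collisions key (X l) ≤ (X l).card + (Q l).card := by
      rw [collisions, ← Finset.diag_card (X l)]
      refine le_trans (Finset.card_le_card fun q hq => ?_) (Finset.card_union_le _ _)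
      rw [Finset.mem_filter, Finset.mem_product] at hq
      rw [Finset.mem_union, Finset.mem_diag]
      by_cases h : q.1 = q.2
      · exact Or.inl ⟨hq.1.1, h⟩
      · exact Or.inr (Finset.mem_filter.2 ⟨Finset.mem_product.2 hq.1, h, hcell q.1 q.2 hq.2⟩)
    omega
  -- Two distinct points determine the line, so each pair of points in a common cell is counted for
  -- at most one line.
  have hpairs : ∑ l ∈ L, (Q l).card ≤ (S.card * d) * (T.card * e) := by
    refine le_trans ?_ (Nat.mul_le_mul (collisions_blockIndex_le S d hd)
      (collisions_blockIndex_le T e he))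
    rw [collisions, collisions, ← Finset.card_product, ← Finset.card_sigma]
    refine Finset.card_le_card_of_injOn (fun z => ((z.1.1 + z.1.2 * z.2.1, z.1.1 + z.1.2 * z.2.2),
      (z.2.1, z.2.2))) ?_ ?_
    · rintro ⟨l, t, t'⟩ hz
      simp only [Finset.coe_sigma, Set.mem_sigma_iff, Finset.mem_coe, Q, X, Finset.mem_filter,
        Finset.mem_product, sameCell] at hz ⊢
      tauto
    · rintro ⟨⟨α, β⟩, t, t'⟩ hz ⟨⟨α', β'⟩, u, u'⟩ hz' h
      have hne : t ≠ t' := by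
        simp only [Finset.coe_sigma, Set.mem_sigma_iff, Finset.mem_coe, Q, Finset.mem_filter] at hz
        exact hz.2.2.1
      simp only [Prod.mk.injEq] at h
      obtain ⟨⟨h1, h2⟩, rfl, rfl⟩ := h
      have hβ : (β - β') * (t - t') = 0 := by linear_combination h1 - h2
      have hβ' : β = β' := by
        rcases mul_eq_zero.1 hβ with h | h
        · linarith
        · exact absurd (by linarith) hne
      subst hβ'
      have : α = α' := by linarith
      subst this
      rfl
  rw [hcard]
  calc ∑ l ∈ L, (X l).card ≤ ∑ l ∈ L, (K + (Q l).card) := Finset.sum_le_sum hline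
    _ = K * L.card + ∑ l ∈ L, (Q l).card := by
        rw [Finset.sum_add_distrib, Finset.sum_const, smul_eq_mul, mul_comm]
    _ ≤ _ := by gcongr

/-! ### Large subsets carrying the energy, and their popular values. -/

/-- For products this regroups ab = cd as a/c = d/b. The variables from X and from Y are separated,
so Cauchy–Schwarz can bound a mixed energy by the two pure ones. -/
theorem card_quotient_agree {α γ δ : Type*} [DecidableEq γ] [DecidableEq δ]
    (A : Finset α) (f : α → α → γ) (g : α → α → δ)
    (hfg : ∀ a ∈ A, ∀ b ∈ A, ∀ c ∈ A, ∀ d ∈ A, f a b = f c d ↔ g a c = g d b)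
    (X Y : Finset α) (hX : X ⊆ A) (hY : Y ⊆ A) :
    collisions (fun p : α × α => f p.1 p.2) (X ×ˢ Y) =
      (((X ×ˢ X) ×ˢ (Y ×ˢ Y)).filter fun q => g q.1.1 q.1.2 = g q.2.1 q.2.2).card := by
  refine Finset.card_nbij' (fun q => ((q.1.1, q.2.1), (q.2.2, q.1.2)))
    (fun q => ((q.1.1, q.2.2), (q.1.2, q.2.1))) ?_ ?_ ?_ ?_
  · rintro ⟨⟨a, b⟩, c, d⟩ hq
    simp only [Finset.mem_coe, Finset.mem_filter, Finset.mem_product] at hq ⊢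
    obtain ⟨⟨⟨ha, hb⟩, hc, hd⟩, h⟩ := hq
    exact ⟨⟨⟨ha, hc⟩, hd, hb⟩, (hfg a (hX ha) b (hY hb) c (hX hc) d (hY hd)).1 h⟩
  · rintro ⟨⟨a, c⟩, d, b⟩ hq
    simp only [Finset.mem_coe, Finset.mem_filter, Finset.mem_product] at hq ⊢
    obtain ⟨⟨⟨ha, hc⟩, hd, hb⟩, h⟩ := hq
    exact ⟨⟨⟨ha, hb⟩, hc, hd⟩, (hfg a (hX ha) b (hY hb) c (hX hc) d (hY hd)).2 h⟩
  · rintro ⟨⟨a, b⟩, c, d⟩ _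
    rfl
  · rintro ⟨⟨a, b⟩, c, d⟩ _
    rfl

theorem fiberCard_le_card_left {α β γ : Type*} [DecidableEq γ] (f : α → β → γ)
    (X : Finset α) (Y : Finset β)
    (hf : ∀ a ∈ X, ∀ b ∈ Y, ∀ c ∈ Y, f a b = f a c → b = c) (y : γ) :
    fiberCard (fun p : α × β => f p.1 p.2) (X ×ˢ Y) y ≤ X.card := by
  refine Finset.card_le_card_of_injOn Prod.fst ?_ ?_
  · intro p hp
    exact (Finset.mem_product.1 (Finset.mem_filter.1 hp).1).1
  · rintro ⟨a, b⟩ hp ⟨a', c⟩ hp' h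
    simp only [Finset.mem_coe, Finset.mem_filter, Finset.mem_product] at hp hp' h
    subst h
    rw [hf a hp.1.1 b hp.1.2 c hp'.1.2 (hp.2.trans hp'.2.symm)]

theorem fiberCard_le_card_right {α β γ : Type*} [DecidableEq γ] (f : α → β → γ)
    (X : Finset α) (Y : Finset β)
    (hf : ∀ a ∈ X, ∀ a' ∈ X, ∀ b ∈ Y, f a b = f a' b → a = a') (y : γ) :
    fiberCard (fun p : α × β => f p.1 p.2) (X ×ˢ Y) y ≤ Y.card := by
  refine Finset.card_le_card_of_injOn Prod.snd ?_ ?_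
  · intro p hp
    exact (Finset.mem_product.1 (Finset.mem_filter.1 hp).1).2
  · rintro ⟨a, b⟩ hp ⟨a', c⟩ hp' h
    simp only [Finset.mem_coe, Finset.mem_filter, Finset.mem_product] at hp hp' h
    subst h
    rw [hf a hp.1.1 a' hp'.1.1 b hp.1.2 (hp.2.trans hp'.2.symm)]

theorem collisions_le_card_pow {α γ : Type*} [DecidableEq γ] (f : α → α → γ) (X : Finset α)
    (hf : ∀ a ∈ X, ∀ b ∈ X, ∀ c ∈ X, f a b = f a c → b = c) :
    collisions (fun p : α × α => f p.1 p.2) (X ×ˢ X) ≤ X.card ^ 3 := by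
  rw [collisions_eq_sum]
  refine (Finset.sum_le_card_nsmul _ _ X.card fun p _ =>
    fiberCard_le_card_left f X X hf _).trans_eq ?_
  rw [Finset.card_product, smul_eq_mul]
  ring

/-- If the elements of `A'` account for half of the energy of `A`, then `A'` is large. -/
theorem collisions_le_of_half_mass {α γ δ : Type*} [DecidableEq γ] [DecidableEq δ]
    (A A' : Finset α) (hA' : A' ⊆ A) (f : α → α → γ) (g : α → α → δ)
    (hfg : ∀ a ∈ A, ∀ b ∈ A, ∀ c ∈ A, ∀ d ∈ A, f a b = f c d ↔ g a c = g d b)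
    (hf : ∀ a ∈ A, ∀ b ∈ A, ∀ c ∈ A, f a b = f a c → b = c)
    (h : collisions (fun p : α × α => f p.1 p.2) (A ×ˢ A) ≤
      2 * ∑ p ∈ A' ×ˢ A, fiberCard (fun p : α × α => f p.1 p.2) (A ×ˢ A) (f p.1 p.2)) :
    collisions (fun p : α × α => f p.1 p.2) (A ×ˢ A) ≤ 16 * A'.card ^ 3 := by
  have h1 := sum_fiberCard_sq_le (fun p : α × α => f p.1 p.2) (A' ×ˢ A) (A ×ˢ A)
  have h2 := card_agree_sq_le (fun p : α × α => g p.1 p.2) (fun p : α × α => g p.1 p.2)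
    (A' ×ˢ A') (A ×ˢ A)
  rw [← card_quotient_agree A f g hfg A' A hA' subset_rfl] at h2
  have h3 : ∀ X : Finset α, X ⊆ A → collisions (fun p : α × α => g p.1 p.2) (X ×ˢ X) =
      collisions (fun p : α × α => f p.1 p.2) (X ×ˢ X) :=
    fun X hX => (card_quotient_agree A f g hfg X X hX hX).symm
  rw [h3 A' hA', h3 A subset_rfl] at h2
  have h4 := collisions_le_card_pow f A' fun a ha b hb c hc =>
    hf a (hA' ha) b (hA' hb) c (hA' hc)
  generalize collisions (fun p : α × α => f p.1 p.2) (A' ×ˢ A) = E at *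
  generalize collisions (fun p : α × α => f p.1 p.2) (A' ×ˢ A') = D at *
  generalize A'.card = n at *
  generalize ∑ p ∈ A' ×ˢ A, fiberCard (fun p : α × α => f p.1 p.2) (A ×ˢ A) (f p.1 p.2) = W at *
  generalize collisions (fun p : α × α => f p.1 p.2) (A ×ˢ A) = M at *
  rcases Nat.eq_zero_or_pos M with rfl | hM
  · exact Nat.zero_le _
  · refine Nat.le_of_mul_le_mul_right (c := M ^ 3) ?_ (by positivity)
    -- Two applications of Cauchy–Schwarz: W² ≤ E·M, then E² ≤ D·M, with D ≤ n³ trivially.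
    calc M * M ^ 3 = M ^ 4 := by ring
      _ ≤ (2 * W) ^ 4 := by gcongr
      _ = 16 * (W ^ 2) ^ 2 := by ring
      _ ≤ 16 * (E * M) ^ 2 := by gcongr
      _ = 16 * (E ^ 2 * M ^ 2) := by ring
      _ ≤ 16 * ((D * M) * M ^ 2) := by gcongr
      _ ≤ 16 * ((n ^ 3 * M) * M ^ 2) := by gcongr
      _ = _ := by ring

/-- Decomposition of a large part of `A` into few classes `B j`, each element of `B j` having at
least `θ j` representations by elements of a set `P j` of popular values of `f`. -/
theorem exists_popular_decomposition {α γ δ : Type*} [DecidableEq α] [DecidableEq γ]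
    [DecidableEq δ] (A : Finset α) (hA : A.Nonempty) (f : α → α → γ) (g : α → α → δ)
    (hfg : ∀ a ∈ A, ∀ b ∈ A, ∀ c ∈ A, ∀ d ∈ A, f a b = f c d ↔ g a c = g d b)
    (hf : ∀ a ∈ A, ∀ b ∈ A, ∀ c ∈ A, f a b = f a c → b = c)
    (J : ℕ) (hJ : A.card < 2 ^ J) (M : ℕ)
    (hM : collisions (fun p : α × α => f p.1 p.2) (A ×ˢ A) = M) :
    ∃ (B : ℕ → Finset α) (P : ℕ → Finset γ) (θ : ℕ → ℕ),
      (∀ j, B j ⊆ A) ∧ M ≤ 16 * ((Finset.range J).biUnion B).card ^ 3 ∧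
      ∀ j, 0 < θ j ∧ (P j).card * 4 ^ j ≤ M ∧ M ≤ 4 * A.card * J * 2 ^ j * θ j ∧
        ∀ a ∈ B j, θ j ≤ (A.filter fun b => f a b ∈ P j).card := by
  set φ : α × α → γ := fun p => f p.1 p.2 with hφ
  set r : γ → ℕ := fiberCard φ (A ×ˢ A) with hr
  have hrpos : ∀ a ∈ A, ∀ b ∈ A, r (f a b) ≠ 0 := fun a ha b hb =>
    Finset.card_ne_zero_of_mem
      (Finset.mem_filter.2 ⟨Finset.mk_mem_product ha hb, rfl⟩)
  have hrlt : ∀ y, r y < 2 ^ J := fun y => (fiberCard_le_card_left f A A hf y).trans_lt hJ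
  have hcard : 0 < A.card := hA.card_pos
  have hJ0 : 0 < J := by
    rcases Nat.eq_zero_or_pos J with rfl | h
    · rw [pow_zero] at hJ
      omega
    · exact h
  let w : α → ℕ := fun a => ∑ b ∈ A, r (f a b)
  have hMw : M = ∑ a ∈ A, w a := by
    rw [← hM, collisions_eq_sum, Finset.sum_product]
  have hMpos : 0 < M := by
    obtain ⟨a, ha⟩ := hA
    rw [hMw]
    refine lt_of_lt_of_le (Nat.pos_of_ne_zero (hrpos a ha a ha)) ?_
    exact (Finset.single_le_sum (f := fun b => r (f a b)) (fun _ _ => Nat.zero_le _) ha).trans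
      (Finset.single_le_sum (f := w) (fun _ _ => Nat.zero_le _) ha)
  -- The threshold is half the average of `w`, so the discarded elements carry at most half of M.
  let A' : Finset α := A.filter fun a => M ≤ 2 * A.card * w a
  have hA'A : A' ⊆ A := Finset.filter_subset _ _
  let P : ℕ → Finset γ := fun j => ((A ×ˢ A).image φ).filter fun y => Nat.log 2 (r y) = j
  let q : ℕ → α → ℕ := fun j a => (A.filter fun b => f a b ∈ P j).card
  -- The factors are 2|A| from the threshold in `A'`, 2·2^j bounding a multiplicity at level j, and
  -- J from the pigeonhole over levels.
  let D : ℕ → ℕ := fun j => 4 * A.card * J * 2 ^ j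
  have hD : ∀ j, 0 < D j := fun j => by positivity
  let B : ℕ → Finset α := fun j => A'.filter fun a => M ≤ D j * q j a
  -- θ is M / D j rounded up: one threshold serving the whole class.
  have hθ : ∀ j, ∃ θ, M ≤ D j * θ ∧ ∀ n, M ≤ D j * n → θ ≤ n := fun j => by
    have hex : ∃ n, M ≤ D j * n := ⟨M, Nat.le_mul_of_pos_left _ (hD j)⟩
    exact ⟨Nat.find hex, Nat.find_spec hex, fun n hn => Nat.find_min' hex hn⟩
  choose θ hθM hθmin using hθ
  have hw : ∀ a ∈ A, w a ≤ ∑ j ∈ Finset.range J, 2 * 2 ^ j * q j a := by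
    intro a ha
    have hmaps : ∀ b ∈ A, Nat.log 2 (r (f a b)) ∈ Finset.range J := fun b hb =>
      Finset.mem_range.2 (Nat.log_lt_of_lt_pow (hrpos a ha b hb) (hrlt _))
    change ∑ b ∈ A, r (f a b) ≤ _
    rw [← Finset.sum_fiberwise_of_maps_to hmaps]
    refine Finset.sum_le_sum fun j _ => ?_
    calc _ ≤ (A.filter fun b => Nat.log 2 (r (f a b)) = j).card • (2 * 2 ^ j) := by
          refine Finset.sum_le_card_nsmul _ _ _ fun b hb => ?_
          have := Nat.lt_pow_succ_log_self (b := 2) (by norm_num) (r (f a b))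
          rw [(Finset.mem_filter.1 hb).2, pow_succ] at this
          omega
      _ ≤ q j a • (2 * 2 ^ j) := by
          refine Nat.mul_le_mul_right _ (Finset.card_le_card fun b hb => ?_)
          rw [Finset.mem_filter] at hb ⊢
          exact ⟨hb.1, Finset.mem_filter.2 ⟨Finset.mem_image.2 ⟨(a, b),
            Finset.mk_mem_product ha hb.1, rfl⟩, hb.2⟩⟩
      _ = _ := by rw [smul_eq_mul]; ring
  have hcover : A' ⊆ (Finset.range J).biUnion B := by
    intro a ha
    have ha' := Finset.mem_filter.1 ha
    have hsum : M ≤ ∑ j ∈ Finset.range J, 2 * A.card * (2 * 2 ^ j * q j a) := by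
      rw [← Finset.mul_sum]
      exact ha'.2.trans (Nat.mul_le_mul_left _ (hw a ha'.1))
    obtain ⟨j, hj, hjM⟩ := exists_le_card_mul_of_le_sum J M hMpos _ hsum
    refine Finset.mem_biUnion.2 ⟨j, hj, Finset.mem_filter.2 ⟨ha, hjM.trans_eq ?_⟩⟩
    simp only [D]
    ring
  have hmass : M ≤ 2 * ∑ a ∈ A', w a := by
    have hsplit : ∑ a ∈ A', w a + ∑ a ∈ A.filter (fun a => ¬ M ≤ 2 * A.card * w a), w a = M := by
      rw [hMw]
      simp only [A', hMw]
      exact Finset.sum_filter_add_sum_filter_not A _ _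
    have hsmall : 2 * A.card * ∑ a ∈ A.filter (fun a => ¬ M ≤ 2 * A.card * w a), w a ≤
        A.card * M := by
      rw [Finset.mul_sum]
      calc _ ≤ (A.filter (fun a => ¬ M ≤ 2 * A.card * w a)).card • M := by
            refine Finset.sum_le_card_nsmul _ _ _ fun a ha => ?_
            exact (not_le.1 (Finset.mem_filter.1 ha).2).le
        _ ≤ _ := Nat.mul_le_mul_right _ (Finset.card_filter_le _ _)
    have : 2 * ∑ a ∈ A.filter (fun a => ¬ M ≤ 2 * A.card * w a), w a ≤ M :=
      Nat.le_of_mul_le_mul_left (by linarith) hcard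
    omega
  refine ⟨B, P, θ, fun j => (Finset.filter_subset _ _).trans hA'A, ?_, fun j => ⟨?_, ?_, hθM j, ?_⟩⟩
  · have hlarge := collisions_le_of_half_mass A A' hA'A f g hfg hf (by
      rw [Finset.sum_product]
      exact hM.trans_le hmass)
    rw [← hM]
    exact hlarge.trans (by gcongr)
  · rcases Nat.eq_zero_or_pos (θ j) with h | h
    · have := hθM j
      rw [h] at this
      omega
    · exact h
  · rw [← hM, collisions_eq_sum_sq φ (A ×ˢ A) _ fun i hi => Finset.mem_image_of_mem _ hi]
    refine le_trans ?_ (Finset.sum_le_sum_of_subset (Finset.filter_subset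
      (fun y => Nat.log 2 (r y) = j) _))
    rw [← smul_eq_mul]
    refine Finset.card_nsmul_le_sum _ _ _ fun y hy => ?_
    obtain ⟨hy, hlog⟩ := Finset.mem_filter.1 hy
    obtain ⟨⟨a, b⟩, hab, rfl⟩ := Finset.mem_image.1 hy
    rw [Finset.mem_product] at hab
    have := Nat.pow_log_le_self 2 (hrpos a hab.1 b hab.2)
    change Nat.log 2 (r (f a b)) = j at hlog
    rw [hlog] at this
    calc 4 ^ j = (2 ^ j) ^ 2 := by rw [← pow_mul, mul_comm, pow_mul]; norm_num
      _ ≤ r (f a b) ^ 2 := by gcongr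
  · intro a ha
    exact hθmin j _ (Finset.mem_filter.1 ha).2

/-! ### From incidences to the energy of one class. -/

/-- For `a, b ∈ T` and `c ∈ A` the relation between `f a c` and `b`, for fixed `c` and `h a b`, is
given by the line `l c (h a b)` in the coordinates `(f a c, ψ b)`. -/
structure IsLineModel (A T : Finset ℝ) (f h : ℝ → ℝ → ℝ) (l : ℝ → ℝ → ℝ × ℝ) (ψ : ℝ → ℝ) :
    Prop where
  subset : T ⊆ A
  cancel : ∀ a ∈ A, ∀ b ∈ A, ∀ c ∈ A, f a b = f a c → b = c
  eq_line : ∀ a ∈ T, ∀ b ∈ T, ∀ c ∈ A, f a c = (l c (h a b)).1 + (l c (h a b)).2 * ψ b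
  slope_ne : ∀ a ∈ T, ∀ b ∈ T, ∀ c ∈ A, (l c (h a b)).2 ≠ 0
  inj : ∀ a ∈ T, ∀ b ∈ T, ∀ c ∈ A, ∀ a' ∈ T, ∀ b' ∈ T, ∀ c' ∈ A,
    l c (h a b) = l c' (h a' b') → ψ b = ψ b' → a = a' ∧ b = b' ∧ c = c'

namespace IsLineModel

variable {A T : Finset ℝ} {f h : ℝ → ℝ → ℝ} {l : ℝ → ℝ → ℝ × ℝ} {ψ : ℝ → ℝ}

theorem cancel_right (H : IsLineModel A T f h l ψ) :
    ∀ a ∈ T, ∀ b ∈ T, ∀ b' ∈ T, h a b = h a b' → b = b' := by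
  intro a ha b hb b' hb' hab
  have haA := H.subset ha
  have h1 := H.eq_line a ha b hb a haA
  have h2 := H.eq_line a ha b' hb' a haA
  rw [← hab] at h2
  have h3 : ψ b = ψ b' :=
    mul_left_cancel₀ (H.slope_ne a ha b hb a haA) (add_left_cancel (h1.symm.trans h2))
  exact (H.inj a ha b hb a haA a ha b' hb' a haA (by rw [hab]) h3).2.1

theorem cancel_left (H : IsLineModel A T f h l ψ) :
    ∀ a ∈ T, ∀ a' ∈ T, ∀ b ∈ T, h a b = h a' b → a = a' := by
  intro a ha a' ha' b hb hab
  have haA := H.subset ha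
  exact (H.inj a ha b hb a haA a' ha' b hb a haA (by rw [hab]) rfl).1

/-- Each (a, b) in B × S with `h a b` in X, and each c with `f a c` in P, place the point (`f a c`,
`ψ b`) on the line `l c (h a b)`; by `inj`, distinct triples give distinct incidences. -/
theorem incidence_bound (H : IsLineModel A T f h l ψ) (B S P : Finset ℝ) (hB : B ⊆ T) (hS : S ⊆ T)
    (θ : ℕ) (hθ : ∀ a ∈ B, θ ≤ (A.filter fun c => f a c ∈ P).card) (τ : ℕ) (X : Finset ℝ)
    (hX : ∀ x ∈ X, τ ≤ fiberCard (fun p : ℝ × ℝ => h p.1 p.2) (B ×ˢ S) x)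
    (d e : ℕ) (hd : 0 < d) (he : 0 < e) :
    θ * τ * X.card ≤ (P.card / d + S.card / e + 1) * (A.card * X.card) +
      (P.card * d) * (S.card * e) := by
  let L : Finset (ℝ × ℝ) := ((A ×ˢ X).image fun p => l p.1 p.2).filter fun m => m.2 ≠ 0
  have hL : L.card ≤ A.card * X.card :=
    (Finset.card_filter_le _ _).trans (Finset.card_image_le.trans_eq (Finset.card_product _ _))
  have hI := card_incidences_le P (S.image ψ) L (fun m hm => (Finset.mem_filter.1 hm).2) d e hd he
  have hS' : (S.image ψ).card ≤ S.card := Finset.card_image_le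
  let Y : Finset (ℝ × ℝ) := (B ×ˢ S).filter fun p => h p.1 p.2 ∈ X
  have hY : τ * X.card ≤ Y.card := by
    rw [card_eq_sum_fiberCard (fun p : ℝ × ℝ => h p.1 p.2) Y X
      fun p hp => (Finset.mem_filter.1 hp).2, mul_comm, ← smul_eq_mul]
    refine Finset.card_nsmul_le_sum _ _ _ fun x hx => (hX x hx).trans ?_
    refine Finset.card_le_card fun p hp => ?_
    rw [Finset.mem_filter] at hp ⊢
    refine ⟨Finset.mem_filter.2 ⟨hp.1, ?_⟩, hp.2⟩
    have hpx : h p.1 p.2 = x := hp.2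
    rwa [hpx]
  have hcount : θ * τ * X.card ≤
      (((L ×ˢ S.image ψ).filter fun q => q.1.1 + q.1.2 * q.2 ∈ P)).card := by
    calc θ * τ * X.card = θ * (τ * X.card) := by ring
      _ ≤ θ * Y.card := by gcongr
      _ = Y.card • θ := by rw [smul_eq_mul, mul_comm]
      _ ≤ ∑ p ∈ Y, (A.filter fun c => f p.1 c ∈ P).card := by
          refine Finset.card_nsmul_le_sum _ _ _ fun p hp => hθ _ ?_
          exact (Finset.mem_product.1 (Finset.mem_filter.1 hp).1).1
      _ = (Y.sigma fun p => A.filter fun c => f p.1 c ∈ P).card := (Finset.card_sigma _ _).symm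
      _ ≤ _ := by
          refine Finset.card_le_card_of_injOn
            (fun z => (l z.2 (h z.1.1 z.1.2), ψ z.1.2)) ?_ ?_
          · rintro ⟨⟨a, b⟩, c⟩ hz
            simp only [Finset.coe_sigma, Set.mem_sigma_iff, Finset.mem_coe, Y, Finset.mem_filter,
              Finset.mem_product] at hz
            obtain ⟨⟨⟨ha, hb⟩, hx⟩, hc, hp⟩ := hz
            simp only [Finset.mem_coe, L, Finset.mem_filter, Finset.mem_product]
            refine ⟨⟨⟨Finset.mem_image.2 ⟨(c, h a b), Finset.mk_mem_product hc hx, rfl⟩,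
              H.slope_ne a (hB ha) b (hS hb) c hc⟩, Finset.mem_image_of_mem _ hb⟩, ?_⟩
            rw [← H.eq_line a (hB ha) b (hS hb) c hc]
            exact hp
          · rintro ⟨⟨a, b⟩, c⟩ hz ⟨⟨a', b'⟩, c'⟩ hz' hzz
            simp only [Finset.coe_sigma, Set.mem_sigma_iff, Finset.mem_coe, Y, Finset.mem_filter,
              Finset.mem_product] at hz hz'
            simp only [Prod.mk.injEq] at hzz
            obtain ⟨rfl, rfl, rfl⟩ := H.inj a (hB hz.1.1.1) b (hS hz.1.1.2) c hz.2.1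
              a' (hB hz'.1.1.1) b' (hS hz'.1.1.2) c' hz'.2.1 hzz.1 hzz.2
            rfl
  refine (hcount.trans hI).trans ?_
  gcongr

theorem rich_bound (H : IsLineModel A T f h l ψ) (B S P : Finset ℝ) (hB : B ⊆ T) (hS : S ⊆ T)
    (θ : ℕ) (hθ : ∀ a ∈ B, θ ≤ (A.filter fun c => f a c ∈ P).card) (τ : ℕ) :
    (τ ^ 2 * (((B ×ˢ S).image fun p => h p.1 p.2).filter fun x =>
      τ ≤ fiberCard (fun p : ℝ × ℝ => h p.1 p.2) (B ×ˢ S) x).card) ^ 2 * θ ^ 3 ≤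
      2048 * A.card ^ 6 * P.card ^ 2 := by
  set X := ((B ×ˢ S).image fun p => h p.1 p.2).filter fun x =>
      τ ≤ fiberCard (fun p : ℝ × ℝ => h p.1 p.2) (B ×ˢ S) x with hXdef
  have hX : ∀ x ∈ X, τ ≤ fiberCard (fun p : ℝ × ℝ => h p.1 p.2) (B ×ˢ S) x :=
    fun x hx => (Finset.mem_filter.1 hx).2
  rcases X.eq_empty_or_nonempty with hXe | ⟨x, hx⟩
  · rw [hXe]
    simp
  obtain ⟨⟨a, b⟩, hab, -⟩ := Finset.mem_image.1 (Finset.mem_filter.1 hx).1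
  rw [Finset.mem_product] at hab
  have hSA : S.card ≤ A.card := Finset.card_le_card (hS.trans H.subset)
  have hBA : B.card ≤ A.card := Finset.card_le_card (hB.trans H.subset)
  have hτS : τ ≤ S.card := (hX x hx).trans (fiberCard_le_card_right h B S
    (fun a ha a' ha' b hb => H.cancel_left a (hB ha) a' (hB ha') b (hS hb)) x)
  have hθA : θ ≤ A.card := (hθ a hab.1).trans (Finset.card_filter_le _ _)
  have hθP : θ ≤ P.card := by
    refine (hθ a hab.1).trans (Finset.card_le_card_of_injOn (f a) ?_ ?_)
    · intro c hc
      exact (Finset.mem_filter.1 hc).2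
    · intro c hc c' hc' hcc
      exact H.cancel a (H.subset (hB hab.1)) c (Finset.mem_filter.1 hc).1 c'
        (Finset.mem_filter.1 hc').1 hcc
  have hτX : τ * X.card ≤ A.card ^ 2 := by
    calc τ * X.card = X.card • τ := by rw [smul_eq_mul, mul_comm]
      _ ≤ ∑ x ∈ X, fiberCard (fun p : ℝ × ℝ => h p.1 p.2) (B ×ˢ S) x :=
          Finset.card_nsmul_le_sum _ _ _ hX
      _ ≤ ∑ x ∈ (B ×ˢ S).image fun p => h p.1 p.2,
            fiberCard (fun p : ℝ × ℝ => h p.1 p.2) (B ×ˢ S) x :=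
          Finset.sum_le_sum_of_subset (Finset.filter_subset _ _)
      _ = (B ×ˢ S).card := (card_eq_sum_fiberCard _ _ _ fun i hi =>
          Finset.mem_image_of_mem _ hi).symm
      _ = B.card * S.card := Finset.card_product _ _
      _ ≤ A.card * A.card := Nat.mul_le_mul hBA hSA
      _ = _ := by ring
  have hinc := H.incidence_bound B S P hB hS θ hθ τ X hX
  generalize X.card = x at *
  generalize A.card = N at *
  generalize P.card = p at *
  generalize S.card = s at *
  -- Below 8N the trivial bounds τ|X| ≤ N² and θ ≤ |P| suffice.
  rcases Nat.lt_or_ge (θ * τ) (8 * N) with hlt | hge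
  · calc (τ ^ 2 * x) ^ 2 * θ ^ 3 = (θ * τ) ^ 2 * (τ * x) ^ 2 * θ := by ring
      _ ≤ (8 * N) ^ 2 * (N ^ 2) ^ 2 * θ := by gcongr
      _ = 64 * N ^ 6 * θ := by ring
      _ ≤ 2048 * N ^ 6 * p ^ 2 := by
          have : θ ≤ p ^ 2 := hθP.trans (Nat.le_self_pow two_ne_zero p)
          gcongr
          norm_num
  · rcases Nat.eq_zero_or_pos (θ * τ) with h0 | hpos
    · rcases Nat.mul_eq_zero.1 h0 with h0 | h0 <;> simp [h0]
    have hN : 0 < N := by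
      rcases Nat.eq_zero_or_pos N with h0 | h0
      · have : θ = 0 := by omega
        simp [this] at hpos
      · exact h0
    -- Cutting each side into at most r blocks makes the cell count at most 3r, so the linear term
    -- is at most 3/8 of the left side and is absorbed. The condition r ≤ p, s keeps the rounded-up
    -- block lengths within 2p/r and 2s/r.
    set r := θ * τ / (8 * N) with hr
    have hr1 : 0 < r := Nat.div_pos hge (by positivity)
    have hr2 : 8 * N * r ≤ θ * τ := Nat.mul_div_le _ _
    have hr3 : θ * τ ≤ 16 * N * r := by
      have := Nat.lt_mul_div_succ (θ * τ) (b := 8 * N) (by positivity)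
      rw [← hr] at this
      nlinarith
    have hrp : r ≤ p := by
      refine Nat.le_of_mul_le_mul_left (c := 8 * N) ?_ (by positivity)
      calc 8 * N * r ≤ θ * τ := hr2
        _ ≤ p * N := Nat.mul_le_mul hθP (hτS.trans hSA)
        _ ≤ 8 * N * p := by nlinarith
    have hrs : r ≤ s := by
      refine Nat.le_of_mul_le_mul_left (c := 8 * N) ?_ (by positivity)
      calc 8 * N * r ≤ θ * τ := hr2
        _ ≤ N * s := Nat.mul_le_mul hθA hτS
        _ ≤ 8 * N * s := by nlinarith
    have hdiv : ∀ m, r ≤ m → m / (m / r + 1) ≤ r ∧ (m / r + 1) * r ≤ 2 * m := by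
      intro m hm
      constructor
      · refine Nat.div_le_of_le_mul ?_
        have := Nat.lt_mul_div_succ m hr1
        linarith
      · have := Nat.div_mul_le_self m r
        linarith
    obtain ⟨hp1, hp2⟩ := hdiv p hrp
    obtain ⟨hs1, hs2⟩ := hdiv s hrs
    have hinc := hinc (p / r + 1) (s / r + 1) (Nat.succ_pos _) (Nat.succ_pos _)
    generalize p / r + 1 = d at *
    generalize s / r + 1 = e at *
    have hmain : 5 * (θ * τ * x) ≤ 8 * ((p * d) * (s * e)) := by
      have h1 : (p / d + s / e + 1) * (N * x) ≤ (3 * r) * (N * x) := by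
        gcongr
        omega
      have h2 : 8 * N * r * x ≤ θ * τ * x := by gcongr
      linarith
    have hcube : (θ * τ) ^ 3 * x ≤ 2048 * N ^ 2 * p ^ 2 * s ^ 2 := by
      have : 5 * ((θ * τ) ^ 3 * x) ≤ 5 * (2048 * N ^ 2 * p ^ 2 * s ^ 2) := by
        calc 5 * ((θ * τ) ^ 3 * x) = 5 * (θ * τ * x) * (θ * τ) ^ 2 := by ring
          _ ≤ 8 * ((p * d) * (s * e)) * (16 * N * r) ^ 2 := by gcongr
          _ = 2048 * N ^ 2 * p * s * (d * r) * (e * r) := by ring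
          _ ≤ 2048 * N ^ 2 * p * s * (2 * p) * (2 * s) := by gcongr
          _ = 4 * (2048 * N ^ 2 * p ^ 2 * s ^ 2) := by ring
          _ ≤ _ := by gcongr; norm_num
      omega
    calc (τ ^ 2 * x) ^ 2 * θ ^ 3 = ((θ * τ) ^ 3 * x) * (τ * x) := by ring
      _ ≤ (2048 * N ^ 2 * p ^ 2 * s ^ 2) * N ^ 2 := by gcongr
      _ ≤ (2048 * N ^ 2 * p ^ 2 * N ^ 2) * N ^ 2 := by gcongr
      _ = _ := by ring

theorem class_bound (H : IsLineModel A T f h l ψ) (B S P : Finset ℝ) (hB : B ⊆ T) (hS : S ⊆ T)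
    (θ : ℕ) (hθ0 : 0 < θ) (hθ : ∀ a ∈ B, θ ≤ (A.filter fun c => f a c ∈ P).card)
    (J j M : ℕ) (hJ : A.card < 2 ^ J) (hP : P.card * 4 ^ j ≤ M)
    (hM : M ≤ 4 * A.card * J * 2 ^ j * θ) :
    (collisions (fun p : ℝ × ℝ => h p.1 p.2) (B ×ˢ S) * M) ^ 2 ≤
      2 ^ 23 * J ^ 6 * A.card ^ 11 := by
  rcases Nat.eq_zero_or_pos (collisions (fun p : ℝ × ℝ => h p.1 p.2) (B ×ˢ S)) with h0 | hpos
  · simp [h0]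
  have hθA : θ ≤ A.card := by
    obtain ⟨q, hq⟩ := Finset.card_pos.1 hpos
    have hq := (Finset.mem_product.1 (Finset.mem_product.1 (Finset.mem_filter.1 hq).1).1).1
    exact (hθ _ hq).trans (Finset.card_filter_le _ _)
  have hfib : ∀ y, fiberCard (fun p : ℝ × ℝ => h p.1 p.2) (B ×ˢ S) y < 2 ^ J := fun y =>
    ((fiberCard_le_card_left h B S (fun a ha b hb c hc =>
      H.cancel_right a (hB ha) b (hS hb) c (hS hc)) y).trans
      (Finset.card_le_card (hB.trans H.subset))).trans_lt hJ
  obtain ⟨i, hi⟩ := collisions_le_dyadic _ _ J hfib hpos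
  have hrich := H.rich_bound B S P hB hS θ hθ (2 ^ i)
  generalize collisions (fun p : ℝ × ℝ => h p.1 p.2) (B ×ˢ S) = E at *
  generalize (2 ^ i) ^ 2 * Finset.card _ = R at *
  generalize A.card = N at *
  generalize P.card = p at *
  have h4 : (4 : ℕ) ^ j = (2 ^ j) ^ 2 := by
    rw [← pow_mul, mul_comm, pow_mul]
    norm_num
  rw [h4] at hP
  have h2j : 0 < 2 ^ j := by positivity
  generalize 2 ^ j = u at *
  -- Multiplying through by θ⁴u⁴, with u = 2^j, avoids dividing by θ and by 4^j.
  refine Nat.le_of_mul_le_mul_right (c := θ ^ 4 * u ^ 4) ?_ (by positivity)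
  calc (E * M) ^ 2 * (θ ^ 4 * u ^ 4) ≤ ((4 * J * R) * M) ^ 2 * (θ ^ 4 * u ^ 4) := by gcongr
    _ = 16 * J ^ 2 * (R ^ 2 * θ ^ 3) * M ^ 2 * θ * u ^ 4 := by ring
    _ ≤ 16 * J ^ 2 * (2048 * N ^ 6 * p ^ 2) * M ^ 2 * θ * u ^ 4 := by gcongr
    _ = 2 ^ 15 * J ^ 2 * N ^ 6 * (p * u ^ 2) ^ 2 * M ^ 2 * θ := by ring
    _ ≤ 2 ^ 15 * J ^ 2 * N ^ 6 * M ^ 2 * M ^ 2 * N := by gcongr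
    _ = 2 ^ 15 * J ^ 2 * N ^ 7 * M ^ 4 := by ring
    _ ≤ 2 ^ 15 * J ^ 2 * N ^ 7 * (4 * N * J * u * θ) ^ 4 := by gcongr
    _ = _ := by ring

end IsLineModel

/-! ### Gluing the classes. -/

/-- A fibre over the union is at most the sum of the fibres over the classes; Cauchy–Schwarz over J
classes costs the factor J. -/
theorem collisions_biUnion_le {α γ : Type*} [DecidableEq α] [DecidableEq γ] (φ : α × α → γ)
    (B : ℕ → Finset α) (J : ℕ) (S : Finset α) :
    collisions φ ((Finset.range J).biUnion B ×ˢ S) ≤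
      J * ∑ j ∈ Finset.range J, collisions φ (B j ×ˢ S) := by
  set U := (Finset.range J).biUnion B with hU
  have hmem : ∀ j ∈ Finset.range J, ∀ q ∈ B j ×ˢ S, φ q ∈ (U ×ˢ S).image φ := by
    intro j hj q hq
    refine Finset.mem_image_of_mem _ ?_
    rw [Finset.mem_product] at hq ⊢
    exact ⟨Finset.mem_biUnion.2 ⟨j, hj, hq.1⟩, hq.2⟩
  rw [collisions_eq_sum_sq φ _ _ fun i hi => Finset.mem_image_of_mem _ hi,
    Finset.sum_congr rfl fun j hj => collisions_eq_sum_sq φ (B j ×ˢ S) _ (hmem j hj),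
    Finset.sum_comm, Finset.mul_sum]
  refine Finset.sum_le_sum fun y _ => ?_
  have hfib : fiberCard φ (U ×ˢ S) y ≤ ∑ j ∈ Finset.range J, fiberCard φ (B j ×ˢ S) y := by
    refine le_trans (Finset.card_le_card fun q hq => ?_) Finset.card_biUnion_le
    rw [Finset.mem_filter, Finset.mem_product] at hq
    obtain ⟨j, hj, hqj⟩ := Finset.mem_biUnion.1 hq.1.1
    exact Finset.mem_biUnion.2 ⟨j, hj, Finset.mem_filter.2
      ⟨Finset.mem_product.2 ⟨hqj, hq.1.2⟩, hq.2⟩⟩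
  calc _ ≤ (∑ j ∈ Finset.range J, fiberCard φ (B j ×ˢ S) y) ^ 2 := by gcongr
    _ ≤ (Finset.range J).card * ∑ j ∈ Finset.range J, fiberCard φ (B j ×ˢ S) y ^ 2 :=
        sq_sum_le_card_mul_sum_sq
    _ = _ := by rw [Finset.card_range]

/-- Gluing and the choice of the worst class cost J each, hence J⁴ after squaring. Zero is removed
only from the `h`-energy; the size of S is measured with it. -/
theorem exists_subset_energy_le (A : Finset ℝ) (hA : A.Nonempty) (f h g : ℝ → ℝ → ℝ)
    (l : ℝ → ℝ → ℝ × ℝ) (ψ : ℝ → ℝ)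
    (hfg : ∀ a ∈ A, ∀ b ∈ A, ∀ c ∈ A, ∀ d ∈ A, f a b = f c d ↔ g a c = g d b)
    (H : IsLineModel A (A.erase 0) f h l ψ) (J : ℕ) (hJ : A.card < 2 ^ J) :
    ∃ S ⊆ A, collisions (fun p : ℝ × ℝ => f p.1 p.2) (A ×ˢ A) ≤ 16 * S.card ^ 3 ∧
      (collisions (fun p : ℝ × ℝ => h p.1 p.2) (S.erase 0 ×ˢ S.erase 0) *
        collisions (fun p : ℝ × ℝ => f p.1 p.2) (A ×ˢ A)) ^ 2 ≤
          2 ^ 23 * J ^ 10 * A.card ^ 11 := by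
  obtain ⟨B, P, θ, hBA, hcard, hB⟩ := exists_popular_decomposition A hA f g hfg H.cancel J hJ _ rfl
  refine ⟨(Finset.range J).biUnion B, Finset.biUnion_subset.2 fun j _ => hBA j, hcard, ?_⟩
  set S := ((Finset.range J).biUnion B).erase 0 with hS
  have hSA : S ⊆ A.erase 0 := Finset.erase_subset_erase _ (Finset.biUnion_subset.2 fun j _ => hBA j)
  have hSU : S = (Finset.range J).biUnion fun j => (B j).erase 0 := by
    ext x
    simp only [hS, Finset.mem_erase, Finset.mem_biUnion]
    tauto
  rcases Nat.eq_zero_or_pos (collisions (fun p : ℝ × ℝ => h p.1 p.2) (S ×ˢ S)) with h0 | hpos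
  · simp [h0]
  have hun : collisions (fun p : ℝ × ℝ => h p.1 p.2) (S ×ˢ S) ≤
      ∑ j ∈ Finset.range J, J * collisions (fun p : ℝ × ℝ => h p.1 p.2) ((B j).erase 0 ×ˢ S) := by
    have := collisions_biUnion_le (fun p : ℝ × ℝ => h p.1 p.2) (fun j => (B j).erase 0) J S
    rwa [← hSU, Finset.mul_sum] at this
  obtain ⟨j, -, hj⟩ := exists_le_card_mul_of_le_sum J _ hpos _ hun
  obtain ⟨hθ0, hP, hM, hθ⟩ := hB j
  have hcl := H.class_bound ((B j).erase 0) S (P j) (Finset.erase_subset_erase _ (hBA j)) hSA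
    (θ j) hθ0 (fun a ha => hθ a (Finset.mem_of_mem_erase ha)) J j _ hJ hP hM
  calc _ ≤ ((J * (J * collisions (fun p : ℝ × ℝ => h p.1 p.2) ((B j).erase 0 ×ˢ S))) *
        collisions (fun p : ℝ × ℝ => f p.1 p.2) (A ×ˢ A)) ^ 2 := by gcongr
    _ = J ^ 4 * (collisions (fun p : ℝ × ℝ => h p.1 p.2) ((B j).erase 0 ×ˢ S) *
        collisions (fun p : ℝ × ℝ => f p.1 p.2) (A ×ˢ A)) ^ 2 := by ring
    _ ≤ J ^ 4 * (2 ^ 23 * J ^ 6 * A.card ^ 11) := by gcongr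
    _ = _ := by ring

/-! ### Sum and product energies, and the effect of zero. -/

theorem addEnergy_eq_collisions (A : Finset ℝ) :
    Finset.addEnergy A A = collisions (fun p : ℝ × ℝ => p.1 + p.2) (A ×ˢ A) := by
  refine Finset.card_nbij' (fun q => ((q.1.1, q.2.1), (q.1.2, q.2.2)))
    (fun q => ((q.1.1, q.2.1), (q.1.2, q.2.2))) ?_ ?_ (fun _ _ => rfl) (fun _ _ => rfl) <;>
  · intro q hq
    simp only [Finset.mem_coe, Finset.mem_filter, Finset.mem_product] at hq ⊢
    tauto

theorem mulEnergy_eq_collisions (A : Finset ℝ) :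
    Finset.mulEnergy A A = collisions (fun p : ℝ × ℝ => p.1 * p.2) (A ×ˢ A) := by
  refine Finset.card_nbij' (fun q => ((q.1.1, q.2.1), (q.1.2, q.2.2)))
    (fun q => ((q.1.1, q.2.1), (q.1.2, q.2.2))) ?_ ?_ (fun _ _ => rfl) (fun _ _ => rfl) <;>
  · intro q hq
    simp only [Finset.mem_coe, Finset.mem_filter, Finset.mem_product] at hq ⊢
    tauto

theorem addEnergy_le_card_pow (A : Finset ℝ) : Finset.addEnergy A A ≤ A.card ^ 3 := by
  rw [addEnergy_eq_collisions]
  exact collisions_le_card_pow (fun a b : ℝ => a + b) A fun a _ b _ c _ => add_left_cancel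

/-- Quadruples with a zero entry contribute little to the multiplicative energy. -/
theorem mulEnergy_le_erase_zero (A : Finset ℝ) :
    Finset.mulEnergy A A ≤ Finset.mulEnergy (A.erase 0) (A.erase 0) + 4 * A.card ^ 2 := by
  -- If a factor vanishes, so does one on the other side of the equation; the four maps list the
  -- positions of the two zeros.
  let i₁ : ℝ × ℝ → (ℝ × ℝ) × (ℝ × ℝ) := fun p => ((0, 0), (p.1, p.2))
  let i₂ : ℝ × ℝ → (ℝ × ℝ) × (ℝ × ℝ) := fun p => ((0, p.1), (p.2, 0))
  let i₃ : ℝ × ℝ → (ℝ × ℝ) × (ℝ × ℝ) := fun p => ((p.1, 0), (0, p.2))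
  let i₄ : ℝ × ℝ → (ℝ × ℝ) × (ℝ × ℝ) := fun p => ((p.1, p.2), (0, 0))
  let Z : Finset ((ℝ × ℝ) × (ℝ × ℝ)) := ((A ×ˢ A).image i₁ ∪ (A ×ˢ A).image i₂) ∪
    ((A ×ˢ A).image i₃ ∪ (A ×ˢ A).image i₄)
  have hZ : Z.card ≤ 4 * A.card ^ 2 := by
    have himg : ∀ i : ℝ × ℝ → (ℝ × ℝ) × (ℝ × ℝ), ((A ×ˢ A).image i).card ≤ A.card ^ 2 :=
      fun i => Finset.card_image_le.trans_eq (by rw [Finset.card_product, sq])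
    have h1 := Finset.card_union_le ((A ×ˢ A).image i₁) ((A ×ˢ A).image i₂)
    have h2 := Finset.card_union_le ((A ×ˢ A).image i₃) ((A ×ˢ A).image i₄)
    have h3 := Finset.card_union_le ((A ×ˢ A).image i₁ ∪ (A ×ˢ A).image i₂)
      ((A ×ˢ A).image i₃ ∪ (A ×ˢ A).image i₄)
    linarith [himg i₁, himg i₂, himg i₃, himg i₄]
  refine le_trans ?_ (Nat.add_le_add_left hZ _)
  refine le_trans (Finset.card_le_card ?_) (Finset.card_union_le _ _)
  rintro ⟨⟨a, b⟩, c, d⟩ hq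
  simp only [Finset.mem_filter, Finset.mem_product] at hq
  obtain ⟨⟨⟨ha, hb⟩, hc, hd⟩, h⟩ := hq
  simp only [Finset.mem_union, Finset.mem_filter, Finset.mem_product, Finset.mem_erase, Z,
    Finset.mem_image, Prod.exists, i₁, i₂, i₃, i₄, Prod.mk.injEq]
  rcases eq_or_ne a 0 with rfl | ha0
  · rw [zero_mul, eq_comm, mul_eq_zero] at h
    rcases h with rfl | rfl
    · exact Or.inr (Or.inl (Or.inl ⟨c, d, ⟨hc, hd⟩, ⟨rfl, rfl⟩, rfl, rfl⟩))
    · exact Or.inr (Or.inl (Or.inr ⟨b, c, ⟨hb, hc⟩, ⟨rfl, rfl⟩, rfl, rfl⟩))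
  rcases eq_or_ne c 0 with rfl | hc0
  · rw [mul_zero, eq_comm, mul_eq_zero] at h
    rcases h with rfl | rfl
    · exact Or.inr (Or.inr (Or.inl ⟨a, d, ⟨ha, hd⟩, ⟨rfl, rfl⟩, rfl, rfl⟩))
    · exact Or.inr (Or.inr (Or.inr ⟨a, b, ⟨ha, hb⟩, ⟨rfl, rfl⟩, rfl, rfl⟩))
  · have hbd : b * d ≠ 0 := h ▸ mul_ne_zero ha0 hc0
    exact Or.inl ⟨⟨⟨⟨ha0, ha⟩, left_ne_zero_of_mul hbd, hb⟩, ⟨hc0, hc⟩,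
      right_ne_zero_of_mul hbd, hd⟩, h⟩

/-- The line is ac = c(a + b) - cb in the coordinates (ac, b); its slope -c is why zero must be
absent from A. -/
theorem exists_subset_addEnergy_le (A : Finset ℝ) (hA : A.Nonempty) (h0 : (0 : ℝ) ∉ A) (J : ℕ)
    (hJ : A.card < 2 ^ J) :
    ∃ S ⊆ A, Finset.mulEnergy A A ≤ 16 * S.card ^ 3 ∧
      (Finset.addEnergy S S * Finset.mulEnergy A A) ^ 2 ≤ 2 ^ 23 * J ^ 10 * A.card ^ 11 := by
  have hne : ∀ a ∈ A, a ≠ 0 := fun a ha h => h0 (h ▸ ha)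
  have H : IsLineModel A (A.erase 0) (fun a b => a * b) (fun a b => a + b)
      (fun c x => (c * x, -c)) id := by
    refine ⟨Finset.erase_subset _ _, fun a ha b _ c _ => mul_left_cancel₀ (hne a ha),
      fun a _ b _ c _ => ?_, fun a _ b _ c hc => neg_ne_zero.2 (hne c hc), ?_⟩
    · simp only [id]
      ring
    · intro a _ b _ c hc a' _ b' _ c' _ hl hb
      simp only [Prod.mk.injEq, neg_inj, id] at hl hb
      obtain ⟨hl, rfl⟩ := hl
      subst hb
      exact ⟨add_right_cancel (mul_left_cancel₀ (hne c hc) hl), rfl, rfl⟩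
  obtain ⟨S, hSA, hcard, hE⟩ := exists_subset_energy_le A hA _ _ (fun a b => a / b) _ _
    (fun a _ b hb c hc d _ => by
      rw [div_eq_div_iff (hne c hc) (hne b hb)]
      constructor <;> intro h <;> linarith) H J hJ
  rw [Finset.erase_eq_of_notMem fun h => h0 (hSA h)] at hE
  refine ⟨S, hSA, ?_, ?_⟩
  · rwa [mulEnergy_eq_collisions]
  · rwa [mulEnergy_eq_collisions, addEnergy_eq_collisions]

/-- The line is a + c = c + (ab)b⁻¹ in the coordinates (a + c, b⁻¹). Only a and b need be nonzero,
so A may contain zero. -/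
theorem exists_subset_mulEnergy_le (A : Finset ℝ) (hA : A.Nonempty) (J : ℕ)
    (hJ : A.card < 2 ^ J) :
    ∃ S ⊆ A, Finset.addEnergy A A ≤ 16 * S.card ^ 3 ∧
      (Finset.mulEnergy (S.erase 0) (S.erase 0) * Finset.addEnergy A A) ^ 2 ≤
        2 ^ 23 * J ^ 10 * A.card ^ 11 := by
  have H : IsLineModel A (A.erase 0) (fun a b => a + b) (fun a b => a * b)
      (fun c x => (c, x)) (fun b => b⁻¹) := by
    refine ⟨Finset.erase_subset _ _, fun a _ b _ c _ => add_left_cancel,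
      fun a _ b hb c _ => ?_, fun a ha b hb c _ => mul_ne_zero (Finset.ne_of_mem_erase ha)
        (Finset.ne_of_mem_erase hb), ?_⟩
    · have := Finset.ne_of_mem_erase hb
      field_simp
      ring
    · intro a _ b hb c _ a' _ b' _ c' _ hl hbb
      simp only [Prod.mk.injEq, inv_inj] at hl hbb
      obtain ⟨rfl, hl⟩ := hl
      subst hbb
      exact ⟨mul_right_cancel₀ (Finset.ne_of_mem_erase hb) hl, rfl, rfl⟩
  obtain ⟨S, hSA, hcard, hE⟩ := exists_subset_energy_le A hA _ _ (fun a b => a - b) _ _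
    (fun a _ b _ c _ d _ => by
      constructor <;> intro h <;> linarith) H J hJ
  refine ⟨S, hSA, ?_, ?_⟩
  · rwa [addEnergy_eq_collisions]
  · rwa [addEnergy_eq_collisions, mulEnergy_eq_collisions]

/-! ### Real exponents and conclusion. -/

theorem quarter_mul_rpow_third_le (M n : ℕ) (h : M ≤ 64 * n ^ 3) :
    (1 / 4 : ℝ) * (M : ℝ) ^ (1 / 3 : ℝ) ≤ n := by
  have h' : (M : ℝ) ≤ (4 * n) ^ (3 : ℕ) := by
    calc (M : ℝ) ≤ 64 * (n : ℝ) ^ 3 := by exact_mod_cast h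
      _ = _ := by ring
  have : (M : ℝ) ^ (1 / 3 : ℝ) ≤ 4 * n := by
    calc (M : ℝ) ^ (1 / 3 : ℝ) ≤ ((4 * (n : ℝ)) ^ (3 : ℕ)) ^ (1 / 3 : ℝ) := by gcongr
      _ = 4 * n := by
        rw [one_div]
        exact Real.pow_rpow_inv_natCast (by positivity) (by norm_num)
  linarith

theorem rpow_eleven_halves_sq (N : ℝ) (hN : 0 ≤ N) : (N ^ (11 / 2 : ℝ)) ^ 2 = N ^ 11 := by
  rw [← Real.rpow_natCast, ← Real.rpow_mul hN, ← Real.rpow_natCast]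
  norm_num

theorem natLog_succ_le (N : ℕ) (hN : 2 ≤ N) : ((Nat.log 2 N + 1 : ℕ) : ℝ) ≤ 4 * Real.log N := by
  have h1 : (Nat.log 2 N : ℝ) * Real.log 2 ≤ Real.log N := by
    rw [← Real.log_pow]
    refine Real.log_le_log (by positivity) ?_
    exact_mod_cast Nat.pow_log_le_self 2 (by omega)
  have h2 : (1 : ℝ) ≤ Nat.log 2 N := by exact_mod_cast Nat.log_pos (by norm_num) hN
  have h3 := Real.log_two_gt_d9
  push_cast
  nlinarith

/-- F is the main term and 8N⁵ absorbs the degenerate contributions, harmless since 5 < 11/2. The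
logarithmic exponent 5 is half of the 10 on J. -/
theorem energy_product_le (N E : ℕ) (hN : 2 ≤ N)
    (hE : ∃ F, F ^ 2 ≤ 2 ^ 23 * (Nat.log 2 N + 1) ^ 10 * N ^ 11 ∧ E ≤ 2 * F + 8 * N ^ 5) :
    (E : ℝ) ≤ 2 ^ 24 * ((N : ℝ) ^ (11 / 2 : ℝ) * Real.log N ^ (5 : ℝ)) := by
  obtain ⟨F, hF, hEF⟩ := hE
  have hJ := natLog_succ_le N hN
  have hJ1 : (1 : ℝ) ≤ ((Nat.log 2 N + 1 : ℕ) : ℝ) := by exact_mod_cast Nat.le_add_left 1 _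
  have hF' : (F : ℝ) ^ 2 ≤ 2 ^ 23 * ((Nat.log 2 N + 1 : ℕ) : ℝ) ^ 10 * (N : ℝ) ^ 11 := by
    exact_mod_cast hF
  have hEF' : (E : ℝ) ≤ 2 * F + 8 * (N : ℝ) ^ 5 := by exact_mod_cast hEF
  generalize ((Nat.log 2 N + 1 : ℕ) : ℝ) = J at *
  have hN' : (1 : ℝ) ≤ N := by exact_mod_cast (by omega : 1 ≤ N)
  have hsq := rpow_eleven_halves_sq N (by positivity)
  have hN5 : (N : ℝ) ^ 5 ≤ (N : ℝ) ^ (11 / 2 : ℝ) := by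
    rw [← Real.rpow_natCast]
    exact Real.rpow_le_rpow_of_exponent_le hN' (by norm_num)
  have hR0 : 0 ≤ (N : ℝ) ^ (11 / 2 : ℝ) := by positivity
  generalize (N : ℝ) ^ (11 / 2 : ℝ) = R at *
  have hlog : Real.log N ^ (5 : ℝ) = Real.log N ^ 5 := by
    rw [← Real.rpow_natCast]
    norm_num
  rw [hlog]
  have hFR : (F : ℝ) ≤ 2 ^ 12 * J ^ 5 * R := by
    refine le_of_sq_le_sq ?_ (by positivity)
    calc (F : ℝ) ^ 2 ≤ 2 ^ 23 * J ^ 10 * (N : ℝ) ^ 11 := hF'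
      _ ≤ 2 ^ 24 * J ^ 10 * (N : ℝ) ^ 11 := by gcongr <;> norm_num
      _ = _ := by rw [← hsq]; ring
  have hJ5 : 1 ≤ J ^ 5 := one_le_pow₀ hJ1
  calc (E : ℝ) ≤ 2 * (2 ^ 12 * J ^ 5 * R) + 8 * (1 * R) := by linarith
    _ ≤ 2 * (2 ^ 12 * J ^ 5 * R) + 8 * (J ^ 5 * R) := by gcongr
    _ = 8200 * (J ^ 5 * R) := by ring
    _ ≤ 2 ^ 14 * ((4 * Real.log N) ^ 5 * R) := by gcongr; norm_num
    _ = _ := by ring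

/-- Energies are counted by `Finset.addEnergy` and `Finset.mulEnergy`; `κ` is the implied constant
of `≫`, and `C`, `c` are the implied constant and logarithmic exponent of `≲`. All three are
absolute: they are chosen before the set `A`. -/
theorem corollary22 :
    ∃ κ C c : ℝ, 0 < κ ∧ 0 < C ∧ 0 < c ∧
      ∀ A : Finset ℝ, 2 ≤ A.card →
        (∃ A₁ : Finset ℝ, A₁ ⊆ A ∧
          κ * (Finset.mulEnergy A A : ℝ) ^ (1 / 3 : ℝ) ≤ (A₁.card : ℝ) ∧
          (Finset.addEnergy A₁ A₁ : ℝ) * (Finset.mulEnergy A A : ℝ) ≤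
            C * ((A.card : ℝ) ^ (11 / 2 : ℝ) * Real.log (A.card : ℝ) ^ c)) ∧
        (∃ A₂ : Finset ℝ, A₂ ⊆ A ∧
          κ * (Finset.addEnergy A A : ℝ) ^ (1 / 3 : ℝ) ≤ (A₂.card : ℝ) ∧
          (Finset.mulEnergy A₂ A₂ : ℝ) * (Finset.addEnergy A A : ℝ) ≤
            C * ((A.card : ℝ) ^ (11 / 2 : ℝ) * Real.log (A.card : ℝ) ^ c)) := by
  refine ⟨1 / 4, 2 ^ 24, 5, by norm_num, by norm_num, by norm_num, fun A hA => ?_⟩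
  have hJ : A.card < 2 ^ (Nat.log 2 A.card + 1) := Nat.lt_pow_succ_log_self (by norm_num) _
  constructor
  · have hzero := mulEnergy_le_erase_zero A
    -- Above 8|A|² the quadruples with a zero, at most 4|A|², are less than half of the energy.
    -- Otherwise A itself serves, since its additive energy is at most |A|³.
    rcases Nat.lt_or_ge (8 * A.card ^ 2) (Finset.mulEnergy A A) with hbig | hsmall
    · have hsub : A.erase 0 ⊆ A := Finset.erase_subset _ _
      have hne : (A.erase 0).Nonempty := by
        rw [← Finset.card_pos]
        have := Finset.pred_card_le_card_erase (s := A) (a := (0 : ℝ))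
        omega
      obtain ⟨S, hSA, hcard, hE⟩ := exists_subset_addEnergy_le (A.erase 0) hne
        (Finset.notMem_erase _ _) _ ((Finset.card_le_card hsub).trans_lt hJ)
      refine ⟨S, hSA.trans hsub, quarter_mul_rpow_third_le _ _ (by omega), ?_⟩
      rw [← Nat.cast_mul]
      refine energy_product_le _ _ hA ⟨_, hE.trans (by gcongr), ?_⟩
      calc _ ≤ Finset.addEnergy S S * (2 * Finset.mulEnergy (A.erase 0) (A.erase 0)) := by
            gcongr
            omega
        _ = 2 * (Finset.addEnergy S S * Finset.mulEnergy (A.erase 0) (A.erase 0)) := by ring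
        _ ≤ _ := Nat.le_add_right _ _
    · refine ⟨A, subset_rfl, quarter_mul_rpow_third_le _ _ ?_, ?_⟩
      · nlinarith [pow_succ A.card 2, Nat.zero_le (A.card ^ 2)]
      · rw [← Nat.cast_mul]
        refine energy_product_le _ _ hA ⟨0, by simp, ?_⟩
        calc _ ≤ A.card ^ 3 * (8 * A.card ^ 2) :=
              Nat.mul_le_mul (addEnergy_le_card_pow A) hsmall
          _ = _ := by ring
  · obtain ⟨S, hSA, hcard, hE⟩ := exists_subset_mulEnergy_le A
      (Finset.card_pos.1 (by omega)) _ hJ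
    refine ⟨S, hSA, quarter_mul_rpow_third_le _ _ (by omega), ?_⟩
    rw [← Nat.cast_mul]
    refine energy_product_le _ _ hA ⟨_, hE, ?_⟩
    have hS : S.card ≤ A.card := Finset.card_le_card hSA
    -- Zero may belong to S; its quadruples cost only O(|A|⁵) in the product of energies.
    have hrest : 4 * S.card ^ 2 * Finset.addEnergy A A ≤ 4 * A.card ^ 2 * A.card ^ 3 := by
      gcongr
      exact addEnergy_le_card_pow A
    calc _ ≤ (Finset.mulEnergy (S.erase 0) (S.erase 0) + 4 * S.card ^ 2) *
          Finset.addEnergy A A := by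
          gcongr
          exact mulEnergy_le_erase_zero S
      _ = Finset.mulEnergy (S.erase 0) (S.erase 0) * Finset.addEnergy A A +
          4 * S.card ^ 2 * Finset.addEnergy A A := by ring
      _ ≤ 2 * (Finset.mulEnergy (S.erase 0) (S.erase 0) * Finset.addEnergy A A) +
          8 * A.card ^ 5 := by
          refine Nat.add_le_add (by omega) (hrest.trans ?_)
          rw [mul_assoc, ← pow_add]
          gcongr
          norm_num
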